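/- Let $\mathfrak g$ be a Lie algebra over $\mathbb Q$ and let $F$ be a number field. Let $\psi:\mathfrak g\otimes_{\mathbb Q}F\to\mathfrak{sl}_3(F)$ be an isomorphism of Lie algebras over $F$, let $V'$ be a $3$-dimensional $F$-vector space, and let $\rho':\mathfrak g\otimes_{\mathbb Q}F\to\mathfrak{gl}(V')$ be the representation obtained by letting the matrices $\psi(y)$ act on $V'$ with respect to some fixed $F$-basis of $V'$. Let $W$ be the $\mathbb Q$-span of some (possibly different) $F$-basis of $V'$, let $V=F\otimes_{\mathbb Q}W$, regarded as a vector space over $\mathbb Q$, and let $\phi:V\to V'$ be the bijective $\mathbb Q$-linear map with $\phi(\alpha\otimes w)=\alpha w$. Define the representation $\rho:\mathfrak g\to\mathfrak{gl}(V)$ over $\mathbb Q$ by $\rho(x)=\phi^{-1}\circ\rho'(x\otimes 1)\circ\phi$, and let $\rho(\mathfrak g)^*\subseteq\mathrm{End}_{\mathbb Q}(V)$ be the associative $\mathbb Q$-algebra generated by $\rho(\mathfrak g)$. Suppose that $\mathfrak g$ is isomorphic to $\mathfrak{sl}_3(\mathbb Q)$ as a Lie algebra over $\mathbb Q$. Then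 $\dim_{\mathbb Q}\rho(\mathfrak g)^*=9$. This holds whether or not the identity of $V$ is included among the generators of $\rho(\mathfrak g)^*$. -/

import Mathlib

open scoped TensorProduct

attribute [local instance 100] LieRing.ofAssociativeRing

noncomputable section

namespace RestrictedScalars

/-- The Lie algebra `sl₃(K)` of trace-zero `3 × 3` matrices over `K`. -/
abbrev sl3 (K : Type*) [Field K] : LieSubalgebra K (Matrix (Fin 3) (Fin 3) K) :=
  LieAlgebra.SpecialLinear.sl (Fin 3) K

section

variable {F : Type*} [Field F] [CharZero F]
variable {V' : Type*} [AddCommGroup V'] [Module F V'] [Module ℚ V']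

/-- The `F`-linear representation `ρ'` of `F ⊗ 𝔤` on the three-dimensional `F`-space `V'`,
given by an isomorphism `ψ : F ⊗ 𝔤 ≃ sl₃(F)`, where a matrix acts on `V'` through the basis `e`. -/
def extRep {𝔤 : Type*} [LieRing 𝔤] [LieAlgebra ℚ 𝔤]
    (ψ : (F ⊗[ℚ] 𝔤) ≃ₗ⁅F⁆ sl3 F) (e : Module.Basis (Fin 3) F V') :
    (F ⊗[ℚ] 𝔤) →ₗ⁅F⁆ Module.End F V' :=
  ((Matrix.toLinAlgEquiv e).toLieEquiv.toLieHom.comp (sl3 F).incl).comp ψ.toLieHom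

/-- The `ℚ`-span `W` of an `F`-basis of `V'`. -/
abbrev ratSpan (b : Module.Basis (Fin 3) F V') : Submodule ℚ V' :=
  Submodule.span ℚ (Set.range b)

/-- The `F`-linear map `F ⊗ W → V'` with `α ⊗ w ↦ α • w`. -/
def phiHom (b : Module.Basis (Fin 3) F V') : (F ⊗[ℚ] ratSpan b) →ₗ[F] V' :=
  (ratSpan b).subtype.liftBaseChange F

theorem phiHom_tmul (b : Module.Basis (Fin 3) F V') (α : F) (w : ratSpan b) :
    phiHom b (α ⊗ₜ[ℚ] w) = α • (w : V') := by
  simp [phiHom]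

theorem linearIndependent_rat (b : Module.Basis (Fin 3) F V') : LinearIndependent ℚ b :=
  b.linearIndependent.restrict_scalars' ℚ

theorem phiHom_bijective (b : Module.Basis (Fin 3) F V') : Function.Bijective (phiHom b) := by
  let c : Module.Basis (Fin 3) ℚ (ratSpan b) := Module.Basis.span (linearIndependent_rat b)
  have key : phiHom b = ((c.baseChange F).equiv b (Equiv.refl _)).toLinearMap := by
    refine (c.baseChange F).ext fun i => ?_
    rw [LinearEquiv.coe_coe, Module.Basis.equiv_apply, Module.Basis.baseChange_apply, phiHom_tmul,
      Module.Basis.span_apply]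
    simp
  rw [key]
  exact LinearEquiv.bijective _

/-- The bijective `ℚ`-linear map `φ : F ⊗ W → V'` with `φ (α ⊗ w) = α • w`. -/
def phi (b : Module.Basis (Fin 3) F V') : (F ⊗[ℚ] ratSpan b) ≃ₗ[ℚ] V' :=
  (LinearEquiv.ofBijective (phiHom b) (phiHom_bijective b)).restrictScalars ℚ

theorem phi_tmul (b : Module.Basis (Fin 3) F V') (α : F) (w : ratSpan b) :
    phi b (α ⊗ₜ[ℚ] w) = α • (w : V') :=
  phiHom_tmul b α w

/-- The representation `ρ : 𝔤 → gl(V)` over `ℚ` on `V = F ⊗ W`, given by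
`ρ x = φ⁻¹ ∘ ρ' (1 ⊗ x) ∘ φ`. -/
def rho {𝔤 : Type*} [LieRing 𝔤] [LieAlgebra ℚ 𝔤]
    (ψ : (F ⊗[ℚ] 𝔤) ≃ₗ⁅F⁆ sl3 F) (e b : Module.Basis (Fin 3) F V') :
    𝔤 →ₗ⁅ℚ⁆ Module.End ℚ (F ⊗[ℚ] ratSpan b) where
  toFun x := (phi b).symm.toLinearMap ∘ₗ
    (extRep ψ e ((1 : F) ⊗ₜ[ℚ] x)).restrictScalars ℚ ∘ₗ (phi b).toLinearMap
  map_add' x y := by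
    ext v
    simp [TensorProduct.tmul_add]
  map_smul' r x := by
    have h : (1 : F) ⊗ₜ[ℚ] (r • x) = (r : F) • ((1 : F) ⊗ₜ[ℚ] x) := by
      rw [← TensorProduct.smul_tmul, TensorProduct.smul_tmul', Rat.smul_def, smul_eq_mul]
    refine LinearMap.ext fun v => ?_
    simp only [h, map_smul, LinearMap.comp_apply, LinearMap.restrictScalars_apply,
      LinearMap.smul_apply, LinearEquiv.coe_coe, RingHom.id_apply]
    rw [← map_smul (phi b).symm]
    congr 1
    rw [Rat.cast_smul_eq_qsmul]
  map_lie' {x y} := by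
    have h : (1 : F) ⊗ₜ[ℚ] ⁅x, y⁆ = ⁅(1 : F) ⊗ₜ[ℚ] x, (1 : F) ⊗ₜ[ℚ] y⁆ := by
      rw [LieAlgebra.ExtendScalars.bracket_tmul, one_mul]
    refine LinearMap.ext fun v => ?_
    simp only [h, LieHom.map_lie, Ring.lie_def, LinearMap.comp_apply, LinearMap.sub_apply,
      LinearMap.restrictScalars_apply, LinearEquiv.coe_coe, Module.End.mul_apply, map_sub,
      LinearEquiv.apply_symm_apply]

theorem rho_apply {𝔤 : Type*} [LieRing 𝔤] [LieAlgebra ℚ 𝔤]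
    (ψ : (F ⊗[ℚ] 𝔤) ≃ₗ⁅F⁆ sl3 F) (e b : Module.Basis (Fin 3) F V') (x : 𝔤)
    (v : F ⊗[ℚ] ratSpan b) :
    rho ψ e b x v = (phi b).symm (Matrix.toLin e e (ψ ((1 : F) ⊗ₜ[ℚ] x)).val (phi b v)) :=
  rfl

end

end RestrictedScalars

end

/-! Extend `𝔤 ≅ sl₃(ℚ) → sl₃(F)` to a unital `ℚ`-linear map `f : M₃(ℚ) → M₃(F)`. It need not be
multiplicative, since `X ↦ -Xᵀ` is an automorphism of `sl₃`, but its image `P` is closed under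
products; being 9-dimensional, `P` is then the generated algebra.

Closure is proved by traces, without classifying automorphisms. The `F`-linear extension of `f`
conjugates `ad X` to `ad (f X)`, so both have the same traces of powers. The square gives `tr (f X)²
= tr X²`; for traceless `X` the sixth power gives `tr (f X)³ = ± tr X³`. Polarization makes every
`tr (f X f Y f Z)` rational. These are the coordinates of `f X f Y` in the `F`-basis `f Eᵢⱼ`, whose
trace-dual basis is `f Eⱼᵢ`, so `f X f Y ∈ P` (`mul_mem_range`). -/

namespace RestrictedScalars

open Matrix

/-! ### Traces of powers of `ad A` on 3 × 3 matrices. -/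

section TraceForms

variable {K : Type*} [Field K]

theorem trace_mulLeft_mul_mulRight (A B : Matrix (Fin 3) (Fin 3) K) :
    LinearMap.trace K _ (LinearMap.mulLeft K A * LinearMap.mulRight K B) = A.trace * B.trace := by
  rw [LinearMap.trace_eq_matrix_trace K (Matrix.stdBasis K (Fin 3) (Fin 3))]
  simp [Matrix.trace, LinearMap.toMatrix_apply, Fintype.sum_prod_type, Matrix.mul_apply,
    Matrix.stdBasis, Fin.sum_univ_three]
  ring

theorem trace_ad_pow (A : Matrix (Fin 3) (Fin 3) K) (n : ℕ) :
    LinearMap.trace K _ ((LinearMap.mulLeft K A - LinearMap.mulRight K A) ^ n) =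
      ∑ m ∈ Finset.range (n + 1),
        (-1) ^ (n - m) * (n.choose m : K) * ((A ^ m).trace * (A ^ (n - m)).trace) := by
  have hc : Commute (LinearMap.mulLeft K A) (-LinearMap.mulRight K A) :=
    (LinearMap.commute_mulLeft_right (R := K) A A).neg_right
  rw [sub_eq_add_neg, hc.add_pow, map_sum]
  refine Finset.sum_congr rfl fun m _ => ?_
  have h : LinearMap.mulLeft K A ^ m * (-LinearMap.mulRight K A) ^ (n - m) *
      (n.choose m : Module.End K (Matrix (Fin 3) (Fin 3) K)) =
      ((-1) ^ (n - m) * (n.choose m : K)) •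
        (LinearMap.mulLeft K (A ^ m) * LinearMap.mulRight K (A ^ (n - m))) := by
    have h1 : (-LinearMap.mulRight K A) ^ (n - m) =
        ((-1 : K) ^ (n - m)) • LinearMap.mulRight K (A ^ (n - m)) := by
      rw [← neg_one_smul K, smul_pow, LinearMap.pow_mulRight]
    have h2 : (n.choose m : Module.End K (Matrix (Fin 3) (Fin 3) K)) = (n.choose m : K) • 1 := by
      rw [Nat.cast_smul_eq_nsmul, nsmul_one]
    rw [LinearMap.pow_mulLeft, h1, h2, mul_smul_comm, mul_smul_comm, smul_mul_assoc, mul_one,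
      smul_smul, mul_comm]
  rw [h, map_smul, trace_mulLeft_mul_mulRight, smul_eq_mul]

theorem trace_ad_sq (A : Matrix (Fin 3) (Fin 3) K) :
    LinearMap.trace K _ ((LinearMap.mulLeft K A - LinearMap.mulRight K A) ^ 2) =
      6 * (A * A).trace - 2 * A.trace ^ 2 := by
  rw [trace_ad_pow]
  simp [Finset.sum_range_succ, ← pow_two]
  ring

variable [CharZero K]

/-- Cayley–Hamilton, with the coefficients written in power sums by Newton's identities. -/
theorem cube_eq_of_trace_eq_zero {A : Matrix (Fin 3) (Fin 3) K} (hA : A.trace = 0) :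
    A ^ 3 = ((A * A).trace / 2) • A + ((A ^ 3).trace / 3) • 1 := by
  have h : A 2 2 = -A 0 0 - A 1 1 := by
    rw [Matrix.trace_fin_three] at hA
    linear_combination hA
  ext i j
  fin_cases i <;> fin_cases j <;>
    simp [pow_succ, Matrix.mul_apply, Fin.sum_univ_three, Matrix.trace_fin_three, h] <;>
    field_simp <;> ring

/-- Six is the least exponent that detects `tr A³`: odd powers of `ad A` have trace zero, and for
traceless `A` the second and fourth depend on `tr A²` alone. -/
theorem trace_ad_pow_six {A : Matrix (Fin 3) (Fin 3) K} (hA : A.trace = 0) :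
    LinearMap.trace K _ ((LinearMap.mulLeft K A - LinearMap.mulRight K A) ^ 6) =
      33 / 2 * (A * A).trace ^ 3 - 18 * (A ^ 3).trace ^ 2 := by
  have h3 := cube_eq_of_trace_eq_zero hA
  set p := (A * A).trace with hp
  set q := (A ^ 3).trace with hq
  have h4 : (A ^ 4).trace = p ^ 2 / 2 := by
    rw [pow_succ, h3, add_mul, smul_mul_assoc, smul_mul_assoc, one_mul, trace_add, trace_smul,
      trace_smul, hA, ← hp, smul_eq_mul, smul_eq_mul]
    ring
  have h6 : (A ^ 6).trace = p ^ 3 / 4 + q ^ 2 / 3 := by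
    have : A ^ 6 = A ^ 3 * A ^ 3 := by rw [← pow_add]
    rw [this, h3]
    simp only [add_mul, mul_add, smul_mul_assoc, mul_smul_comm, one_mul, mul_one, trace_add,
      trace_smul, hA, ← hp, smul_eq_mul, trace_one, Fintype.card_fin]
    push_cast
    ring
  have h2 : (A ^ 2).trace = p := by rw [pow_two]
  rw [trace_ad_pow]
  simp [Finset.sum_range_succ, h2, h4, h6, hA, ← hq, Nat.choose]
  ring

end TraceForms

/-! ### Rationality of traces on the image of a spanning Lie map. -/

section LieImage

variable {F : Type*} [Field F] [CharZero F]

theorem trace_map_algebraMap (X : Matrix (Fin 3) (Fin 3) ℚ) :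
    (X.map (algebraMap ℚ F)).trace = (X.trace : F) := by
  simp [Matrix.trace]

/-- The `F`-linear extension to `M₃(F)` of a `ℚ`-linear map `M₃(ℚ) → M₃(F)`. -/
noncomputable def scalarExtension (f : Matrix (Fin 3) (Fin 3) ℚ →ₗ[ℚ] Matrix (Fin 3) (Fin 3) F) :
    Matrix (Fin 3) (Fin 3) F →ₗ[F] Matrix (Fin 3) (Fin 3) F :=
  (Matrix.stdBasis F (Fin 3) (Fin 3)).constr F fun p => f (Matrix.single p.1 p.2 1)

theorem scalarExtension_map (f : Matrix (Fin 3) (Fin 3) ℚ →ₗ[ℚ] Matrix (Fin 3) (Fin 3) F)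
    (X : Matrix (Fin 3) (Fin 3) ℚ) :
    scalarExtension f (X.map (algebraMap ℚ F)) = f X := by
  conv_rhs => rw [Matrix.matrix_eq_sum_single X]
  conv_lhs => rw [Matrix.matrix_eq_sum_single (X.map (algebraMap ℚ F))]
  simp only [map_sum]
  refine Finset.sum_congr rfl fun i _ => Finset.sum_congr rfl fun j _ => ?_
  have h1 : Matrix.single i j ((X.map (algebraMap ℚ F)) i j) =
      (X i j : F) • Matrix.stdBasis F (Fin 3) (Fin 3) (i, j) := by
    simp [Matrix.stdBasis_eq_single]
  have h2 : Matrix.single i j (X i j) = X i j • Matrix.single i j (1 : ℚ) := by simp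
  rw [h1, h2, map_smul, map_smul, scalarExtension, Module.Basis.constr_basis,
    Rat.cast_smul_eq_qsmul]

/-- A unital, trace-preserving homomorphism of Lie algebras `M₃(ℚ) → M₃(F)` over `ℚ`
whose image spans `M₃(F)` over `F`. -/
structure IsSpanningLieMap (f : Matrix (Fin 3) (Fin 3) ℚ →ₗ[ℚ] Matrix (Fin 3) (Fin 3) F) :
    Prop where
  map_one : f 1 = 1
  map_commutator : ∀ X Y, f (X * Y - Y * X) = f X * f Y - f Y * f X
  trace_map : ∀ X, (f X).trace = X.trace
  span_range : Submodule.span F (Set.range f) = ⊤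

namespace IsSpanningLieMap

variable {f : Matrix (Fin 3) (Fin 3) ℚ →ₗ[ℚ] Matrix (Fin 3) (Fin 3) F}

theorem scalarExtension_bijective (hf : IsSpanningLieMap f) :
    Function.Bijective (scalarExtension f) := by
  have hs : Function.Surjective (scalarExtension f) := by
    rw [← LinearMap.range_eq_top, eq_top_iff, ← hf.span_range, Submodule.span_le]
    rintro _ ⟨X, rfl⟩
    exact ⟨_, scalarExtension_map f X⟩
  exact ⟨LinearMap.injective_iff_surjective.mpr hs, hs⟩

/-- Both sides are `F`-linear in `Y`, so it suffices to take `Y` a matrix unit; these are rational,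
and `f` respects commutators. -/
theorem scalarExtension_commutator (hf : IsSpanningLieMap f) (X : Matrix (Fin 3) (Fin 3) ℚ)
    (Y : Matrix (Fin 3) (Fin 3) F) :
    scalarExtension f (X.map (algebraMap ℚ F) * Y - Y * X.map (algebraMap ℚ F)) =
      f X * scalarExtension f Y - scalarExtension f Y * f X := by
  let l : Matrix (Fin 3) (Fin 3) F →ₗ[F] Matrix (Fin 3) (Fin 3) F := scalarExtension f ∘ₗ
    (LinearMap.mulLeft F (X.map (algebraMap ℚ F)) - LinearMap.mulRight F (X.map (algebraMap ℚ F)))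
  let r : Matrix (Fin 3) (Fin 3) F →ₗ[F] Matrix (Fin 3) (Fin 3) F :=
    (LinearMap.mulLeft F (f X) - LinearMap.mulRight F (f X)) ∘ₗ scalarExtension f
  suffices h : l = r from LinearMap.congr_fun h Y
  refine (Matrix.stdBasis F (Fin 3) (Fin 3)).ext fun p => ?_
  have hp : Matrix.stdBasis F (Fin 3) (Fin 3) p =
      (Matrix.single p.1 p.2 (1 : ℚ)).map (algebraMap ℚ F) := by
    rw [Matrix.stdBasis_eq_single, Matrix.map_single]
    simp
  have hm : X.map (algebraMap ℚ F) * (Matrix.single p.1 p.2 (1 : ℚ)).map (algebraMap ℚ F) -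
      (Matrix.single p.1 p.2 (1 : ℚ)).map (algebraMap ℚ F) * X.map (algebraMap ℚ F) =
      (X * Matrix.single p.1 p.2 1 - Matrix.single p.1 p.2 1 * X).map (algebraMap ℚ F) := by
    rw [Matrix.map_sub _ (map_sub _), Matrix.map_mul, Matrix.map_mul]
  simp only [l, r, hp, LinearMap.comp_apply, LinearMap.sub_apply, LinearMap.mulLeft_apply,
    LinearMap.mulRight_apply, hm, scalarExtension_map, hf.map_commutator]

theorem trace_ad_pow_map (hf : IsSpanningLieMap f) (X : Matrix (Fin 3) (Fin 3) ℚ) (n : ℕ) :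
    LinearMap.trace F _ ((LinearMap.mulLeft F (f X) - LinearMap.mulRight F (f X)) ^ n) =
      LinearMap.trace F _ ((LinearMap.mulLeft F (X.map (algebraMap ℚ F)) -
        LinearMap.mulRight F (X.map (algebraMap ℚ F))) ^ n) := by
  let s := LinearEquiv.ofBijective (scalarExtension f) hf.scalarExtension_bijective
  have h : LinearMap.mulLeft F (f X) - LinearMap.mulRight F (f X) =
      s.conj (LinearMap.mulLeft F (X.map (algebraMap ℚ F)) -
        LinearMap.mulRight F (X.map (algebraMap ℚ F))) := by
    refine LinearMap.ext fun Y => ?_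
    obtain ⟨Y, rfl⟩ := s.surjective Y
    rw [LinearEquiv.conj_apply_apply, LinearEquiv.symm_apply_apply]
    exact (hf.scalarExtension_commutator X Y).symm
  exact (congrArg _ (by rw [h]; exact (map_pow (s.conjAlgEquiv F) _ n).symm)).trans
    (LinearMap.trace_conj' _ s)

theorem trace_sq_map (hf : IsSpanningLieMap f) (X : Matrix (Fin 3) (Fin 3) ℚ) :
    (f X * f X).trace = ((X * X).trace : ℚ) := by
  have h := hf.trace_ad_pow_map X 2
  have h1 := trace_map_algebraMap (F := F) X
  have h2 : (X.map (algebraMap ℚ F) * X.map (algebraMap ℚ F)).trace = ((X * X).trace : ℚ) := by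
    rw [← Matrix.map_mul, trace_map_algebraMap]
  rw [trace_ad_sq, trace_ad_sq, hf.trace_map, h1, h2] at h
  linear_combination h / 6

theorem trace_mul_map (hf : IsSpanningLieMap f) (X Y : Matrix (Fin 3) (Fin 3) ℚ) :
    (f X * f Y).trace = ((X * Y).trace : ℚ) := by
  have h := hf.trace_sq_map (X + Y)
  simp only [map_add, add_mul, mul_add, trace_add, hf.trace_sq_map, trace_mul_comm (f Y) (f X),
    trace_mul_comm Y X, Rat.cast_add] at h
  linear_combination h / 2

/-- Only the square of `tr (f X)³` is determined; the sign is genuinely ambiguous because of `X ↦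
-Xᵀ`, but either sign is rational. -/
theorem trace_cube_map_of_trace_eq_zero (hf : IsSpanningLieMap f)
    {X : Matrix (Fin 3) (Fin 3) ℚ} (hX : X.trace = 0) :
    ∃ q : ℚ, (f X ^ 3).trace = q := by
  have h := hf.trace_ad_pow_map X 6
  have h1 : (X.map (algebraMap ℚ F)).trace = 0 := by
    rw [trace_map_algebraMap, hX, Rat.cast_zero]
  have h2 : (X.map (algebraMap ℚ F) * X.map (algebraMap ℚ F)).trace = ((X * X).trace : ℚ) := by
    rw [← Matrix.map_mul, trace_map_algebraMap]
  have h3 : (X.map (algebraMap ℚ F) ^ 3).trace = ((X ^ 3).trace : ℚ) := by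
    rw [← Matrix.map_pow, trace_map_algebraMap]
  rw [trace_ad_pow_six h1, trace_ad_pow_six (by rw [hf.trace_map, hX, Rat.cast_zero]), h2, h3,
    hf.trace_sq_map] at h
  have hsq : (f X ^ 3).trace ^ 2 = ((X ^ 3).trace : F) ^ 2 := by
    linear_combination -h / 18
  rcases sq_eq_sq_iff_eq_or_eq_neg.mp hsq with h | h
  · exact ⟨_, h⟩
  · exact ⟨-(X ^ 3).trace, by rw [h, Rat.cast_neg]⟩

theorem trace_cube_map (hf : IsSpanningLieMap f) (X : Matrix (Fin 3) (Fin 3) ℚ) :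
    ∃ q : ℚ, (f X ^ 3).trace = q := by
  set c : ℚ := X.trace / 3 with hc
  set Y := X - c • (1 : Matrix (Fin 3) (Fin 3) ℚ) with hY
  have hYt : Y.trace = 0 := by
    rw [hY, trace_sub, trace_smul, trace_one, hc]
    simp
  obtain ⟨q, hq⟩ := hf.trace_cube_map_of_trace_eq_zero hYt
  have hX : f X = f Y + (c : F) • (1 : Matrix (Fin 3) (Fin 3) F) := by
    rw [hY, map_sub, map_smul, hf.map_one, Rat.cast_smul_eq_qsmul, sub_add_cancel]
  refine ⟨q + 3 * c * (Y * Y).trace + 3 * c ^ 3, ?_⟩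
  have ht : (f Y).trace = 0 := by rw [hf.trace_map, hYt, Rat.cast_zero]
  have hq' : (f Y * f Y * f Y).trace = q := by rw [← hq, pow_succ, pow_two]
  rw [hX, pow_succ, pow_two]
  simp only [add_mul, mul_add, smul_mul_assoc, mul_smul_comm, one_mul, mul_one, trace_add,
    trace_smul, ht, hq', hf.trace_sq_map, smul_eq_mul, trace_one, Fintype.card_fin]
  push_cast
  ring

theorem trace_mul_mul_map (hf : IsSpanningLieMap f) (X Y Z : Matrix (Fin 3) (Fin 3) ℚ) :
    ∃ q : ℚ, (f X * f Y * f Z).trace = q := by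
  obtain ⟨a, ha⟩ := hf.trace_cube_map (X + Y + Z)
  obtain ⟨b, hb⟩ := hf.trace_cube_map (X + Y)
  obtain ⟨c, hc⟩ := hf.trace_cube_map (Y + Z)
  obtain ⟨d, hd⟩ := hf.trace_cube_map (X + Z)
  obtain ⟨x, hx⟩ := hf.trace_cube_map X
  obtain ⟨y, hy⟩ := hf.trace_cube_map Y
  obtain ⟨z, hz⟩ := hf.trace_cube_map Z
  -- The part antisymmetric in `Y, Z`: `tr (f X [f Y, f Z])` is a value of the preserved trace form.
  have hs := hf.trace_mul_map X (Y * Z - Z * Y)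
  rw [hf.map_commutator, mul_sub, trace_sub, ← mul_assoc, ← mul_assoc] at hs
  -- The symmetric part: full polarization of the cubic form `tr (f X)³` sums all six orderings,
  -- which form two cyclic classes of three.
  have hpol : (f (X + Y + Z) ^ 3).trace - (f (X + Y) ^ 3).trace - (f (Y + Z) ^ 3).trace -
      (f (X + Z) ^ 3).trace + (f X ^ 3).trace + (f Y ^ 3).trace + (f Z ^ 3).trace =
      3 * ((f X * f Y * f Z).trace + (f X * f Z * f Y).trace) := by
    have h1 : (f Y * f Z * f X).trace = (f X * f Y * f Z).trace := by
      rw [trace_mul_comm, mul_assoc]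
    have h2 : (f Z * f X * f Y).trace = (f X * f Y * f Z).trace := by
      rw [mul_assoc, trace_mul_comm]
    have h3 : (f Z * f Y * f X).trace = (f X * f Z * f Y).trace := by
      rw [trace_mul_comm, mul_assoc]
    have h4 : (f Y * f X * f Z).trace = (f X * f Z * f Y).trace := by
      rw [mul_assoc, trace_mul_comm]
    simp only [pow_succ, pow_zero, one_mul, map_add, add_mul, mul_add, trace_add, h1, h2, h3, h4]
    ring
  rw [ha, hb, hc, hd, hx, hy, hz] at hpol
  refine ⟨((a - b - c - d + x + y + z) / 3 + (X * (Y * Z - Z * Y)).trace) / 2, ?_⟩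
  push_cast
  linear_combination -hpol / 6 + hs / 2

/-- Since `f` preserves the trace form, `f Eᵢⱼ` and `f Eⱼᵢ` are dual families, as the matrix units
are; spanning extends the expansion to all of `M₃(F)`. -/
theorem eq_sum_trace_smul (hf : IsSpanningLieMap f) (A : Matrix (Fin 3) (Fin 3) F) :
    A = ∑ i, ∑ j, (A * f (Matrix.single j i 1)).trace • f (Matrix.single i j 1) := by
  let r : Matrix (Fin 3) (Fin 3) F →ₗ[F] Matrix (Fin 3) (Fin 3) F :=
    ∑ i, ∑ j, ((Matrix.traceLinearMap (Fin 3) F F) ∘ₗ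
      LinearMap.mulRight F (f (Matrix.single j i 1))).smulRight (f (Matrix.single i j 1))
  suffices h : LinearMap.id = r by
    simpa [r, LinearMap.sum_apply] using LinearMap.congr_fun h A
  refine LinearMap.ext_on_range hf.span_range fun X => ?_
  have hX : f X = ∑ i, ∑ j, (X i j : F) • f (Matrix.single i j 1) := by
    conv_lhs => rw [Matrix.matrix_eq_sum_single X]
    simp only [map_sum]
    refine Finset.sum_congr rfl fun i _ => Finset.sum_congr rfl fun j _ => ?_
    rw [Rat.cast_smul_eq_qsmul, ← map_smul, Matrix.smul_single, smul_eq_mul, mul_one]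
  have ht (i j : Fin 3) : (f X * f (Matrix.single j i 1)).trace = (X i j : F) := by
    rw [hf.trace_mul_map, Matrix.trace_mul_single]
    simp
  simp only [r, LinearMap.sum_apply, LinearMap.smulRight_apply, LinearMap.comp_apply,
    LinearMap.mulRight_apply, Matrix.traceLinearMap_apply, ht, LinearMap.id_apply]
  exact hX

theorem mul_mem_range (hf : IsSpanningLieMap f) (X Y : Matrix (Fin 3) (Fin 3) ℚ) :
    f X * f Y ∈ LinearMap.range f := by
  rw [hf.eq_sum_trace_smul (f X * f Y)]
  refine Submodule.sum_mem _ fun i _ => Submodule.sum_mem _ fun j _ => ?_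
  obtain ⟨q, hq⟩ := hf.trace_mul_mul_map X Y (Matrix.single j i 1)
  rw [hq, Rat.cast_smul_eq_qsmul]
  exact Submodule.smul_mem _ _ ⟨_, rfl⟩

theorem injective (hf : IsSpanningLieMap f) : Function.Injective f := by
  intro X Y h
  rw [← scalarExtension_map, ← scalarExtension_map f Y] at h
  exact Matrix.map_injective (algebraMap ℚ F).injective (hf.scalarExtension_bijective.1 h)

end IsSpanningLieMap

end LieImage

/-! ### The spanning Lie map attached to `ψ`, and its action on `F ⊗ W`. -/

section Representation

variable {𝔤 : Type*} [LieRing 𝔤] [LieAlgebra ℚ 𝔤] {F : Type*} [Field F] [CharZero F]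

theorem trace_eq_zero_of_mem_sl3 {K : Type*} [Field K] {A : Matrix (Fin 3) (Fin 3) K}
    (hA : A ∈ sl3 K) : A.trace = 0 :=
  LinearMap.mem_ker.mp hA

/-- The projection of `M₃(K)` onto `sl₃(K)` along the scalar matrices. -/
noncomputable def tracelessPart (K : Type*) [Field K] [CharZero K] :
    Matrix (Fin 3) (Fin 3) K →ₗ[K] sl3 K where
  toFun X := ⟨X - (X.trace / 3) • 1, by
    refine LinearMap.mem_ker.mpr ?_
    simp [Matrix.trace_sub, Matrix.trace_smul, Matrix.trace_one]⟩
  map_add' X Y := by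
    ext1
    simp only [Matrix.trace_add, AddMemClass.coe_add, add_div, add_smul]
    abel
  map_smul' r X := by
    ext1
    simp [Matrix.trace_smul, smul_sub, smul_smul, mul_div_assoc]

theorem coe_tracelessPart {K : Type*} [Field K] [CharZero K] (X : Matrix (Fin 3) (Fin 3) K) :
    (tracelessPart K X : Matrix (Fin 3) (Fin 3) K) = X - (X.trace / 3) • 1 :=
  rfl

theorem tracelessPart_coe {K : Type*} [Field K] [CharZero K] (x : sl3 K) :
    tracelessPart K (x : Matrix (Fin 3) (Fin 3) K) = x := by
  ext1
  rw [coe_tracelessPart, trace_eq_zero_of_mem_sl3 x.2]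
  simp

/-- The unital extension `M₃(ℚ) → M₃(F)` of the map `sl₃(ℚ) ≃ 𝔤 → sl₃(F)`. -/
noncomputable def matrixMap (θ : 𝔤 ≃ₗ⁅ℚ⁆ sl3 ℚ) (ψ : (F ⊗[ℚ] 𝔤) ≃ₗ⁅F⁆ sl3 F) :
    Matrix (Fin 3) (Fin 3) ℚ →ₗ[ℚ] Matrix (Fin 3) (Fin 3) F where
  toFun X := (X.trace / 3) • 1 +
    (ψ ((1 : F) ⊗ₜ[ℚ] θ.symm (tracelessPart ℚ X)) : Matrix (Fin 3) (Fin 3) F)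
  map_add' X Y := by
    simp only [Matrix.trace_add, add_div, add_smul, map_add, TensorProduct.tmul_add,
      AddMemClass.coe_add]
    abel
  map_smul' r X := by
    have h (t : F ⊗[ℚ] 𝔤) : r • t = (r : F) • t := (Rat.cast_smul_eq_qsmul F r t).symm
    rw [Matrix.trace_smul, map_smul, map_smul, TensorProduct.tmul_smul, h, map_smul,
      SetLike.val_smul, smul_add, smul_eq_mul, mul_div_assoc, mul_smul, Rat.cast_smul_eq_qsmul]
    rfl

theorem matrixMap_apply (θ : 𝔤 ≃ₗ⁅ℚ⁆ sl3 ℚ) (ψ : (F ⊗[ℚ] 𝔤) ≃ₗ⁅F⁆ sl3 F)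
    (X : Matrix (Fin 3) (Fin 3) ℚ) :
    matrixMap θ ψ X = (X.trace / 3) • 1 +
      (ψ ((1 : F) ⊗ₜ[ℚ] θ.symm (tracelessPart ℚ X)) : Matrix (Fin 3) (Fin 3) F) :=
  rfl

theorem matrixMap_coe (θ : 𝔤 ≃ₗ⁅ℚ⁆ sl3 ℚ) (ψ : (F ⊗[ℚ] 𝔤) ≃ₗ⁅F⁆ sl3 F) (x : 𝔤) :
    matrixMap θ ψ (θ x : Matrix (Fin 3) (Fin 3) ℚ) =
      (ψ ((1 : F) ⊗ₜ[ℚ] x) : Matrix (Fin 3) (Fin 3) F) := by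
  rw [matrixMap_apply, tracelessPart_coe, trace_eq_zero_of_mem_sl3 (θ x).2,
    LieEquiv.symm_apply_apply]
  simp

theorem matrixMap_one (θ : 𝔤 ≃ₗ⁅ℚ⁆ sl3 ℚ) (ψ : (F ⊗[ℚ] 𝔤) ≃ₗ⁅F⁆ sl3 F) :
    matrixMap θ ψ 1 = 1 := by
  have h : tracelessPart ℚ 1 = 0 := by
    ext1
    rw [coe_tracelessPart]
    simp
  rw [matrixMap_apply, h]
  simp

theorem isSpanningLieMap_matrixMap (θ : 𝔤 ≃ₗ⁅ℚ⁆ sl3 ℚ) (ψ : (F ⊗[ℚ] 𝔤) ≃ₗ⁅F⁆ sl3 F) :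
    IsSpanningLieMap (matrixMap θ ψ) where
  map_one := matrixMap_one θ ψ
  map_commutator X Y := by
    have ht : (X * Y - Y * X).trace = 0 := by
      rw [Matrix.trace_sub, Matrix.trace_mul_comm, sub_self]
    have h : tracelessPart ℚ (X * Y - Y * X) = ⁅tracelessPart ℚ X, tracelessPart ℚ Y⁆ := by
      ext1
      rw [coe_tracelessPart, ht, LieSubalgebra.coe_bracket, Ring.lie_def, coe_tracelessPart,
        coe_tracelessPart]
      simp only [sub_mul, mul_sub, smul_mul_assoc, mul_smul_comm, one_mul, mul_one, zero_div,
        zero_smul, smul_sub]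
      rw [smul_comm (Y.trace / 3)]
      abel
    have h1 (x y : 𝔤) : (1 : F) ⊗ₜ[ℚ] ⁅x, y⁆ = ⁅(1 : F) ⊗ₜ[ℚ] x, (1 : F) ⊗ₜ[ℚ] y⁆ := by
      rw [LieAlgebra.ExtendScalars.bracket_tmul, one_mul]
    simp only [matrixMap_apply]
    rw [ht, h, LieEquiv.map_lie, h1, LieEquiv.map_lie, LieSubalgebra.coe_bracket, Ring.lie_def]
    simp only [add_mul, mul_add, smul_mul_assoc, mul_smul_comm, one_mul, mul_one, zero_div,
      zero_smul, smul_add]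
    rw [smul_comm (Y.trace / 3)]
    abel
  trace_map X := by
    rw [matrixMap_apply, Matrix.trace_add, Matrix.trace_smul,
      trace_eq_zero_of_mem_sl3 (Subtype.property _), Matrix.trace_one,
      ← Rat.cast_smul_eq_qsmul F, smul_eq_mul, Fintype.card_fin]
    push_cast
    ring
  span_range := by
    rw [eq_top_iff]
    rintro A -
    have hA : A = (A.trace / 3) • matrixMap θ ψ 1 +
        (tracelessPart F A : Matrix (Fin 3) (Fin 3) F) := by
      rw [matrixMap_one, coe_tracelessPart]
      abel
    obtain ⟨t, ht⟩ := ψ.surjective (tracelessPart F A)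
    rw [hA, ← ht]
    refine add_mem (Submodule.smul_mem _ _ (Submodule.subset_span ⟨_, rfl⟩)) ?_
    clear ht
    induction t with
    | zero => simp
    | add x y hx hy =>
      rw [map_add, AddMemClass.coe_add]
      exact add_mem hx hy
    | tmul a x =>
      have h : a ⊗ₜ[ℚ] x = a • ((1 : F) ⊗ₜ[ℚ] x) := by
        rw [TensorProduct.smul_tmul', smul_eq_mul, mul_one]
      rw [h, map_smul, SetLike.val_smul]
      exact Submodule.smul_mem _ _ (Submodule.subset_span ⟨_, matrixMap_coe θ ψ x⟩)

variable {V' : Type*} [AddCommGroup V'] [Module F V'] [Module ℚ V']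

/-- The action of `M₃(F)` on `F ⊗ W`, transported from `V'` along `φ`. -/
noncomputable def matrixAction (e b : Module.Basis (Fin 3) F V') :
    Matrix (Fin 3) (Fin 3) F →ₐ[ℚ] Module.End ℚ (F ⊗[ℚ] ratSpan b) :=
  AlgHom.ofLinearMap
    { toFun := fun A => (phi b).symm.toLinearMap ∘ₗ
        (Matrix.toLin e e A).restrictScalars ℚ ∘ₗ (phi b).toLinearMap
      map_add' := fun A B => by
        ext v
        simp
      map_smul' := fun r A => by
        refine LinearMap.ext fun v => ?_
        simp only [← Rat.cast_smul_eq_qsmul F, map_smul, LinearMap.comp_apply,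
          LinearMap.restrictScalars_apply, LinearMap.smul_apply, LinearEquiv.coe_coe,
          RingHom.id_apply]
        rw [Rat.cast_smul_eq_qsmul, map_smul, Rat.cast_smul_eq_qsmul] }
    (by
      refine LinearMap.ext fun v => ?_
      simp)
    (fun A B => by
      refine LinearMap.ext fun v => ?_
      simp [Matrix.toLin_mul e e e])

theorem matrixAction_apply (e b : Module.Basis (Fin 3) F V') (A : Matrix (Fin 3) (Fin 3) F)
    (v : F ⊗[ℚ] ratSpan b) :
    matrixAction e b A v = (phi b).symm (Matrix.toLin e e A (phi b v)) :=
  rfl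

theorem matrixAction_injective (e b : Module.Basis (Fin 3) F V') :
    Function.Injective (matrixAction e b) := by
  intro A B h
  refine (Matrix.toLin e e).injective (LinearMap.ext fun v => ?_)
  obtain ⟨v, rfl⟩ := (phi b).surjective v
  exact (phi b).symm.injective (LinearMap.congr_fun h v)

theorem rho_eq_matrixAction (ψ : (F ⊗[ℚ] 𝔤) ≃ₗ⁅F⁆ sl3 F) (e b : Module.Basis (Fin 3) F V')
    (x : 𝔤) : rho ψ e b x = matrixAction e b (ψ ((1 : F) ⊗ₜ[ℚ] x)).val :=
  LinearMap.ext fun v => by rw [rho_apply, matrixAction_apply]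

end Representation

/-- Both algebras equal `P`, the image of `T ∘ f`. As `P` is spanned by `1` and `S`, the non-unital
case reduces to producing `1` from products of generators. -/
theorem finrank_adjoin_eq_of_isSpanningLieMap {F : Type*} [Field F] [CharZero F]
    {B : Type*} [Ring B] [Algebra ℚ B]
    {f : Matrix (Fin 3) (Fin 3) ℚ →ₗ[ℚ] Matrix (Fin 3) (Fin 3) F} (hf : IsSpanningLieMap f)
    {T : Matrix (Fin 3) (Fin 3) F →ₐ[ℚ] B} (hT : Function.Injective T) {S : Set B}
    (hS : S = Set.range fun x : sl3 ℚ => T (f x)) :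
    Module.finrank ℚ (Algebra.adjoin ℚ S) = 9 ∧
      Module.finrank ℚ (NonUnitalAlgebra.adjoin ℚ S) = 9 := by
  let P : Submodule ℚ B := LinearMap.range (T.toLinearMap ∘ₗ f)
  have hP : Module.finrank ℚ P = 9 := by
    rw [LinearMap.finrank_range_of_inj (hT.comp hf.injective), Module.finrank_matrix]
    simp
  have hP1 : (1 : B) ∈ P := ⟨1, by simp [hf.map_one]⟩
  have hPm : ∀ {x y}, x ∈ P → y ∈ P → x * y ∈ P := by
    rintro _ _ ⟨X, rfl⟩ ⟨Y, rfl⟩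
    obtain ⟨Z, hZ⟩ := hf.mul_mem_range X Y
    exact ⟨Z, by simp [hZ]⟩
  have hSP : S ⊆ P := by
    rw [hS]
    rintro _ ⟨x, rfl⟩
    exact ⟨x, rfl⟩
  have hdecomp (X : Matrix (Fin 3) (Fin 3) ℚ) :
      T (f X) = (X.trace / 3) • 1 + T (f (tracelessPart ℚ X)) := by
    rw [coe_tracelessPart]
    simp [hf.map_one]
  have hmem (X : Matrix (Fin 3) (Fin 3) ℚ) :
      T (f (tracelessPart ℚ X)) ∈ NonUnitalAlgebra.adjoin ℚ S :=
    NonUnitalAlgebra.subset_adjoin ℚ (hS ▸ ⟨_, rfl⟩)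
  have hone : (1 : B) ∈ NonUnitalAlgebra.adjoin ℚ S := by
    -- With `H = diag(1, -1, 0)`, write `f(H)² = f Z`. Then `tr Z = tr H² = 2`, so removing the
    -- traceless part of `Z` leaves the scalar `2/3`, whence the factor `3/2`.
    let H : Matrix (Fin 3) (Fin 3) ℚ := Matrix.single 0 0 1 - Matrix.single 1 1 1
    have hH : (tracelessPart ℚ H : Matrix (Fin 3) (Fin 3) ℚ) = H := by
      rw [coe_tracelessPart]
      simp [H, Matrix.trace_sub]
    obtain ⟨Z, hZ⟩ := hf.mul_mem_range H H
    have hZt : Z.trace = 2 := by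
      have h := hf.trace_map Z
      rw [hZ, hf.trace_mul_map] at h
      have h' : (H * H).trace = 2 := by
        simp [H, Matrix.trace_fin_three, Matrix.mul_apply, Matrix.single_apply]
        norm_num
      rw [← Rat.cast_injective h, h']
    have h1 : (1 : B) = (3 / 2 : ℚ) • (T (f (tracelessPart ℚ H)) * T (f (tracelessPart ℚ H)) -
        T (f (tracelessPart ℚ Z))) := by
      rw [hH, ← map_mul, ← hZ, hdecomp Z, add_sub_cancel_right, hZt, smul_smul]
      norm_num
    rw [h1]
    exact SMulMemClass.smul_mem _ (sub_mem (mul_mem (hmem H) (hmem H)) (hmem Z))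
  have hnon : (NonUnitalAlgebra.adjoin ℚ S).toSubmodule = P := by
    apply le_antisymm
    · let N : NonUnitalSubalgebra ℚ B := { P with mul_mem' := hPm }
      exact (NonUnitalAlgebra.adjoin_le hSP : NonUnitalAlgebra.adjoin ℚ S ≤ N)
    · rintro _ ⟨X, rfl⟩
      change T (f X) ∈ NonUnitalAlgebra.adjoin ℚ S
      rw [hdecomp]
      exact add_mem (SMulMemClass.smul_mem _ hone) (hmem X)
  have hun : Subalgebra.toSubmodule (Algebra.adjoin ℚ S) = P := by
    apply le_antisymm
    · exact (Algebra.adjoin_le hSP : Algebra.adjoin ℚ S ≤ P.toSubalgebra hP1 fun _ _ => hPm)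
    · rw [← hnon]
      exact (NonUnitalAlgebra.adjoin_le Algebra.subset_adjoin :
        NonUnitalAlgebra.adjoin ℚ S ≤ (Algebra.adjoin ℚ S).toNonUnitalSubalgebra)
  constructor
  · rw [← hP, ← hun]
    rfl
  · rw [← hP, ← hnon]
    rfl

end RestrictedScalars

theorem mainTheorem12
    {𝔤 : Type*} [LieRing 𝔤] [LieAlgebra ℚ 𝔤]
    {F : Type*} [Field F] [NumberField F]
    {V' : Type*} [AddCommGroup V'] [Module F V'] [Module ℚ V']
    (h𝔤 : Nonempty (𝔤 ≃ₗ⁅ℚ⁆ RestrictedScalars.sl3 ℚ))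
    (ψ : (F ⊗[ℚ] 𝔤) ≃ₗ⁅F⁆ RestrictedScalars.sl3 F)
    (e b : Module.Basis (Fin 3) F V') :
    Module.finrank ℚ
        (Algebra.adjoin ℚ (Set.range (RestrictedScalars.rho ψ e b))) = 9 ∧
      Module.finrank ℚ
        (NonUnitalAlgebra.adjoin ℚ (Set.range (RestrictedScalars.rho ψ e b))) = 9 := by

  obtain ⟨θ⟩ := h𝔤
  refine RestrictedScalars.finrank_adjoin_eq_of_isSpanningLieMap
    (RestrictedScalars.isSpanningLieMap_matrixMap θ ψ)
    (RestrictedScalars.matrixAction_injective e b) ?_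
  -- Reindexes the generators from `sl₃(ℚ)` to `𝔤` along `θ`.
  rw [← θ.surjective.range_comp]
  congr 1
  funext x
  rw [RestrictedScalars.rho_eq_matrixAction, ← RestrictedScalars.matrixMap_coe θ]
  rfl
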